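/- All Hilbert spaces are finite-dimensional and a state is a positive semidefinite operator of unit trace. For a state $\rho^{X}$ put $S(X)=-\mathrm{Tr}\,\rho^{X}\log_2\rho^{X}$ (with $0\log_2 0=0$). For a state $\rho^{AB}$ with reduced states $\rho^A,\rho^B$ put $I(A:B)=S(A)+S(B)-S(AB)$ and $$J(A|B)=\max_{\{E_i\}}\Big(S(A)-\sum_i p_i\,S(\rho_i^A)\Big),\qquad D(A|B)=I(A:B)-J(A|B),$$ where the maximum is over all POVMs $\{E_i\}$ on $B$ with finitely many outcomes, $p_i=\mathrm{Tr}\big((I\otimes E_i)\rho^{AB}\big)$, $\rho_i^A=\mathrm{Tr}_B\big((I\otimes E_i)\rho^{AB}\big)/p_i$, and outcomes with $p_i=0$ contribute $0$. Here $B$ is the measured system; for a state on $ABC$ the quantities $D(A|B)$, $J(A|B)$, $J(C|B)$, $S(B)$ are those of its reduced states. Then for every tripartite state $\rho^{ABC}$ the maxima defining $J(A|B)$ and $J(C|B)$ are attained, and $$D(A|B)+J(C|B)\le S(B).$$ If $\rho^{ABC}$ is pure, equality holds; that is, for every tripartite pure state on $ABE$, $$D(A|B)+J(E|B)=S(B).$$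 -/

import Mathlib

open scoped Kronecker ComplexOrder

/-! Finite-dimensional quantum systems: the system `X` has Hilbert space `ℂ^X` for a finite
index type `X`, operators are square matrices, and `X × Y` indexes the tensor product. -/

namespace QuantumDiscord

section Defs

variable {A B C X Y : Type*} [Fintype A] [DecidableEq A] [Fintype B] [DecidableEq B]
  [Fintype C] [DecidableEq C] [Fintype X] [DecidableEq X] [Fintype Y] [DecidableEq Y]

/-- Density matrices: positive semidefinite with unit trace. -/
def IsState (ρ : Matrix X X ℂ) : Prop :=
  ρ.PosSemidef ∧ ρ.trace = 1

/-- `ρ` has the form `|ψ⟩⟨ψ|` (for a state `ρ`, the vector `ψ` then has norm one). -/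
def IsPure (ρ : Matrix X X ℂ) : Prop :=
  ∃ ψ : X → ℂ, ρ = Matrix.vecMulVec ψ (star ψ)

/-- Partial trace over the second factor. -/
def traceRight (M : Matrix (X × Y) (X × Y) ℂ) : Matrix X X ℂ :=
  Matrix.of fun x x' => ∑ y, M (x, y) (x', y)

/-- Partial trace over the first factor. -/
def traceLeft (M : Matrix (X × Y) (X × Y) ℂ) : Matrix Y Y ℂ :=
  Matrix.of fun y y' => ∑ x, M (x, y) (x, y')

/-- The marginal on `AB` of an operator on `ABC`. -/
def marginalAB (ρ : Matrix (A × B × C) (A × B × C) ℂ) : Matrix (A × B) (A × B) ℂ :=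
  Matrix.of fun x x' => ∑ c, ρ (x.1, x.2, c) (x'.1, x'.2, c)

/-- The marginal on `CB` (with `C` written first) of an operator on `ABC`. -/
def marginalCB (ρ : Matrix (A × B × C) (A × B × C) ℂ) : Matrix (C × B) (C × B) ℂ :=
  Matrix.of fun x x' => ∑ a, ρ (a, x.2, x.1) (a, x'.2, x'.1)

/-- The marginal on `B` of an operator on `ABC`. -/
def marginalB (ρ : Matrix (A × B × C) (A × B × C) ℂ) : Matrix B B ℂ :=
  Matrix.of fun b b' => ∑ a, ∑ c, ρ (a, b, c) (a, b', c)

/-- Von Neumann entropy `S(ρ) = -Tr (ρ log₂ ρ)`, with `log₂ ρ` given by functional calculus.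
`Real.logb 2 0 = 0`, so zero eigenvalues contribute `0 log 0 = 0`. -/
noncomputable def entropy (ρ : Matrix X X ℂ) : ℝ :=
  -(ρ * cfc (Real.logb 2) ρ).trace.re

/-- Mutual information `I(A:B) = S(A) + S(B) - S(AB)`. -/
noncomputable def mutualInfo (ρ : Matrix (A × B) (A × B) ℂ) : ℝ :=
  entropy (traceRight ρ) + entropy (traceLeft ρ) - entropy ρ

/-- Positive operator valued measures with finitely many outcomes. -/
def IsPOVM {n : ℕ} (E : Fin n → Matrix B B ℂ) : Prop :=
  (∀ i, (E i).PosSemidef) ∧ ∑ i, E i = 1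

/-- The probability `Tr ((1 ⊗ F) ρ)` of the outcome with effect `F` on `B`. -/
noncomputable def outcomeProb (F : Matrix B B ℂ) (ρ : Matrix (A × B) (A × B) ℂ) : ℝ :=
  (((1 : Matrix A A ℂ) ⊗ₖ F) * ρ).trace.re

/-- The state `Tr_B ((1 ⊗ F) ρ) / p` of `A` conditioned on the outcome with effect `F` on `B`,
where `p` is its probability (and `0` if `p = 0`). -/
noncomputable def postState (F : Matrix B B ℂ) (ρ : Matrix (A × B) (A × B) ℂ) : Matrix A A ℂ :=
  ((outcomeProb F ρ)⁻¹ : ℂ) • traceRight (((1 : Matrix A A ℂ) ⊗ₖ F) * ρ)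

/-- The information `S(A) - ∑ pᵢ S(A|Eᵢ)` on `A` gained by measuring `E` on `B`. -/
noncomputable def measurementGain {n : ℕ} (ρ : Matrix (A × B) (A × B) ℂ)
    (E : Fin n → Matrix B B ℂ) : ℝ :=
  entropy (traceRight ρ) - ∑ i, outcomeProb (E i) ρ * entropy (postState (E i) ρ)

/-- The values of `S(A) - ∑ pᵢ S(A|Eᵢ)` over all POVMs on `B`. -/
def gainSet (ρ : Matrix (A × B) (A × B) ℂ) : Set ℝ :=
  {x | ∃ (n : ℕ) (E : Fin n → Matrix B B ℂ), IsPOVM E ∧ x = measurementGain ρ E}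

/-- Classical correlation `J(A|B)`, measuring `B`. -/
noncomputable def classicalCorrelation (ρ : Matrix (A × B) (A × B) ℂ) : ℝ :=
  sSup (gainSet ρ)

/-- Quantum discord `D(A|B) = I(A:B) - J(A|B)`, measuring `B`. -/
noncomputable def discord (ρ : Matrix (A × B) (A × B) ℂ) : ℝ :=
  mutualInfo ρ - classicalCorrelation ρ

end Defs

end QuantumDiscord

/-! For a pure state, a rank-one effect on `B` leaves an unnormalised vector on `AC`, so the two
conditional states share their nonzero spectrum. Entropy is concave, so splitting effects into
rank-one pieces never lowers the gain, and optimal measurements may be taken rank one. Hence `J(A|B)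
- S(A) = J(C|B) - S(C)`, and `S(AB) = S(C)` turns this into the equality.

A general state is purified by a system `R` joined to `C`. The equality holds with `CR` in place of
`C`, and `J(C|B) ≤ J(CR|B)` because the Holevo quantity decreases under partial trace. That rests on
monotonicity of relative entropy (`relEntropy_traceRight_le`), obtained from a variational formula
for resolvent quasi-entropies. Concavity of entropy is the case where everything is traced out
(`sum_scaledEntropy_le`).

The maxima exist because a POVM is, after rescaling, a convex decomposition of the maximally mixed
state, and convex hulls of compact sets are compact in finite dimension. -/

open scoped Kronecker ComplexOrder

namespace QuantumDiscord

open Matrix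

variable {A B C X Y : Type*} [Fintype A] [DecidableEq A] [Fintype B] [DecidableEq B]
  [Fintype C] [DecidableEq C] [Fintype X] [DecidableEq X] [Fintype Y] [DecidableEq Y]

/-! ### Spectral formulas and continuity of the entropy. -/

section Entropy

theorem entropy_eq_trace_cfc {M : Matrix X X ℂ} (hM : M.IsHermitian) :
    entropy M = (cfc (fun x => Real.negMulLog x / Real.log 2) M).trace.re := by
  have hc : ∀ f : ℝ → ℝ, ContinuousOn f (spectrum ℝ M) :=
    fun f => Matrix.finite_real_spectrum.continuousOn f
  have h : M * cfc (Real.logb 2) M = cfc (fun x => x * Real.logb 2 x) M := by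
    rw [cfc_mul (fun x => x) (Real.logb 2) M (hc _) (hc _), cfc_id' ℝ M hM.isSelfAdjoint]
  have h2 : cfc (fun x => Real.negMulLog x / Real.log 2) M
      = - cfc (fun x => x * Real.logb 2 x) M := by
    rw [← cfc_neg]
    congr 1
    ext x
    simp only [Real.negMulLog, Real.logb]
    ring
  rw [entropy, h, h2]
  simp

theorem entropy_eq_sum_eigenvalues {M : Matrix X X ℂ} (hM : M.IsHermitian) :
    entropy M = ∑ i, Real.negMulLog (hM.eigenvalues i) / Real.log 2 := by
  rw [entropy_eq_trace_cfc hM, hM.cfc_eq, IsHermitian.cfc, Unitary.conjStarAlgAut_apply,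
    trace_mul_comm, ← mul_assoc]
  simp only [Unitary.coe_star_mul_self, one_mul, trace_diagonal, Function.comp_apply,
    Complex.re_sum]
  rfl

/-- Characteristic polynomials allow comparison of entropies of matrices of different sizes without
matching eigenbases. -/
theorem entropy_eq_sum_roots {M : Matrix X X ℂ} (hM : M.IsHermitian) :
    entropy M = (M.charpoly.roots.map fun z => Real.negMulLog z.re / Real.log 2).sum := by
  rw [entropy_eq_sum_eigenvalues hM, hM.roots_charpoly_eq_eigenvalues, Multiset.map_map]
  simp

theorem entropy_transpose {M : Matrix X X ℂ} (hM : M.IsHermitian) : entropy Mᵀ = entropy M := by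
  rw [entropy_eq_sum_roots hM, entropy_eq_sum_roots hM.transpose, charpoly_transpose]

/-- The two characteristic polynomials agree up to powers of the variable, and the extra zero roots
contribute `0 log 0 = 0`. -/
theorem entropy_mul_conjTranspose (N : Matrix X Y ℂ) : entropy (N * Nᴴ) = entropy (Nᴴ * N) := by
  rw [entropy_eq_sum_roots (isHermitian_mul_conjTranspose_self N),
    entropy_eq_sum_roots (isHermitian_conjTranspose_mul_self N)]
  have h := congrArg
    (fun p => (p.roots.map fun z : ℂ => Real.negMulLog z.re / Real.log 2).sum)
    (charpoly_mul_comm' N Nᴴ)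
  have h1 : ∀ (k : ℕ) (p : Polynomial ℂ), p.Monic →
      ((Polynomial.X ^ k * p).roots.map fun z : ℂ => Real.negMulLog z.re / Real.log 2).sum
      = (p.roots.map fun z : ℂ => Real.negMulLog z.re / Real.log 2).sum := by
    intro k p hp
    rw [Polynomial.roots_mul (mul_ne_zero (pow_ne_zero _ Polynomial.X_ne_zero) hp.ne_zero)]
    simp [Multiset.map_nsmul, Multiset.sum_nsmul]
  rwa [h1 _ _ (charpoly_monic _), h1 _ _ (charpoly_monic _)] at h

theorem entropy_smul {M : Matrix X X ℂ} (hM : M.IsHermitian) (t : ℝ) :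
    entropy ((t : ℂ) • M) = t * entropy M - t * Real.logb 2 t * M.trace.re := by
  have hc : ∀ f : ℝ → ℝ, ∀ N : Matrix X X ℂ, ContinuousOn f (spectrum ℝ N) :=
    fun f N => Matrix.finite_real_spectrum.continuousOn f
  have hs : (t : ℂ) • M = t • M := by ext; simp
  have ha : IsSelfAdjoint M := hM
  have hT : (t • M).IsHermitian := by
    rw [IsHermitian, conjTranspose_smul, hM.eq, star_trivial]
  have hd : (cfc (fun x => Real.negMulLog (t * x) / Real.log 2) M)
      = t • cfc (fun x => Real.negMulLog x / Real.log 2) M + (- (t * Real.logb 2 t)) • M := by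
    have h1 : (- (t * Real.logb 2 t)) • M = cfc (fun x : ℝ => (- (t * Real.logb 2 t)) • x) M := by
      rw [cfc_smul _ (fun x : ℝ => x) M (hc _ _), cfc_id' ℝ M ha]
    rw [h1, ← cfc_smul _ _ M (hc _ _), ← cfc_add M _ _ (hc _ _) (hc _ _)]
    congr 1
    ext x
    simp only [Real.negMulLog_mul, smul_eq_mul, Real.logb]
    simp only [Real.negMulLog]
    ring
  rw [hs, entropy_eq_trace_cfc hT, entropy_eq_trace_cfc hM,
    ← cfc_comp_const_mul t _ M (hf := (Set.Finite.image _ Matrix.finite_real_spectrum).continuousOn _)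
      (ha := ha), hd]
  simp
  ring

-- The operator norm supplies the C⋆-structure in which the functional calculus is continuous;
-- `Real.negMulLog`, unlike the logarithm, is continuous at zero.
open scoped Matrix.Norms.L2Operator in
theorem continuousOn_entropy : ContinuousOn (entropy (X := X)) {M | M.PosSemidef} := by
  have h : ContinuousOn
      (fun M : Matrix X X ℂ => (cfc (fun x => Real.negMulLog x / Real.log 2) M).trace.re)
      {M | M.PosSemidef} := by
    refine Complex.continuous_re.comp_continuousOn
      ((continuous_id.matrix_trace).comp_continuousOn ?_)
    refine ContinuousOn.cfc_of_mem_nhdsSet (s := Set.univ) _ Filter.univ_mem continuousOn_id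
      (fun M hM => hM.isHermitian) ?_
    exact (Real.continuous_negMulLog.div_const _).continuousOn
  exact h.congr fun M hM => entropy_eq_trace_cfc hM.isHermitian

end Entropy

/-! ### Monotonicity of relative entropy and of the Holevo quantity. -/

section RelativeEntropy

set_option linter.unusedSectionVars false

open Filter Topology in
/-- Comparison of logarithmic sums from comparison of their resolvent sums, by
`log x = ∫ (1 / (1 + t) - 1 / (x + t)) dt`. -/
theorem sum_mul_log_le_of_resolvent_le {ι κ : Type*} [Fintype ι] [Fintype κ] (w x : ι → ℝ)
    (v y : κ → ℝ) (hx : ∀ i, 0 < x i) (hy : ∀ k, 0 < y k) (hwv : ∑ i, w i = ∑ k, v k)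
    (h : ∀ t : ℝ, 0 ≤ t → ∑ k, v k / (y k + t) ≤ ∑ i, w i / (x i + t)) :
    ∑ i, w i * Real.log (x i) ≤ ∑ k, v k * Real.log (y k) := by
  -- Differentiating in the shift `T` replaces the integral: `G` has the resolvent difference as
  -- derivative, so it increases on `[0, ∞)`, and it tends to `0` because the total weights agree.
  -- Hence `G 0 ≤ 0`.
  set G : ℝ → ℝ := fun T => ∑ i, w i * Real.log (x i + T) - ∑ k, v k * Real.log (y k + T) with hG
  have hd : ∀ T : ℝ, 0 ≤ T →
      HasDerivAt G (∑ i, w i / (x i + T) - ∑ k, v k / (y k + T)) T := by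
    intro T hT
    refine HasDerivAt.sub (HasDerivAt.fun_sum fun i _ => ?_) (HasDerivAt.fun_sum fun k _ => ?_)
    · have := (((hasDerivAt_id T).const_add (x i)).log
        (by simpa using (add_pos_of_pos_of_nonneg (hx i) hT).ne')).const_mul (w i)
      simpa [div_eq_mul_inv] using this
    · have := (((hasDerivAt_id T).const_add (y k)).log
        (by simpa using (add_pos_of_pos_of_nonneg (hy k) hT).ne')).const_mul (v k)
      simpa [div_eq_mul_inv] using this
  have hmono : MonotoneOn G (Set.Ici 0) := by
    refine monotoneOn_of_deriv_nonneg (convex_Ici 0)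
      (fun T hT => (hd T hT).continuousAt.continuousWithinAt)
      (fun T hT => (hd T (interior_subset hT)).differentiableAt.differentiableWithinAt)
      (fun T hT => ?_)
    rw [(hd T (interior_subset hT)).deriv]
    exact sub_nonneg.2 (h T (interior_subset hT))
  have hG' : ∀ T, G T = ∑ i, w i * (Real.log (T + x i) - Real.log T)
      - ∑ k, v k * (Real.log (T + y k) - Real.log T) := by
    intro T
    simp only [hG, mul_sub, Finset.sum_sub_distrib, ← Finset.sum_mul, hwv, add_comm T]
    ring
  have hlim : Tendsto G atTop (𝓝 0) := by
    have : Tendsto (fun T => ∑ i, w i * (Real.log (T + x i) - Real.log T)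
      - ∑ k, v k * (Real.log (T + y k) - Real.log T)) atTop
        (𝓝 (∑ i, w i * 0 - ∑ k, v k * 0)) :=
      (tendsto_finsetSum _ fun i _ => (Real.tendsto_log_comp_add_sub_log _).const_mul _).sub
        (tendsto_finsetSum _ fun i _ => (Real.tendsto_log_comp_add_sub_log _).const_mul _)
    simpa [← hG'] using this
  have h0 : G 0 ≤ 0 := by
    refine ge_of_tendsto hlim ?_
    filter_upwards [eventually_ge_atTop 0] with T hT
    exact hmono (Set.mem_Ici.2 le_rfl) hT hT
  simpa [hG] using h0

/-- The overlap `|⟨u_i, w_j⟩|²` of eigenvectors of two Hermitian matrices. -/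
noncomputable def overlap {ρ σ : Matrix X X ℂ} (hρ : ρ.IsHermitian) (hσ : σ.IsHermitian)
    (ij : X × X) : ℝ :=
  Complex.normSq ((star (hσ.eigenvectorUnitary : Matrix X X ℂ) * hρ.eigenvectorUnitary) ij.2 ij.1)

/-- Expanding each factor in its own eigenbasis reduces a trace of noncommuting operators to a
classical double sum. -/
theorem trace_cfc_mul_cfc {ρ σ : Matrix X X ℂ} (hρ : ρ.IsHermitian) (hσ : σ.IsHermitian)
    (f g : ℝ → ℝ) :
    (cfc f ρ * cfc g σ).trace.re =
      ∑ ij, f (hρ.eigenvalues ij.1) * overlap hρ hσ ij * g (hσ.eigenvalues ij.2) := by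
  set U := (hρ.eigenvectorUnitary : Matrix X X ℂ) with hU
  set W := (hσ.eigenvectorUnitary : Matrix X X ℂ) with hW
  rw [hρ.cfc_eq, hσ.cfc_eq, IsHermitian.cfc, IsHermitian.cfc, Unitary.conjStarAlgAut_apply,
    Unitary.conjStarAlgAut_apply, ← hU, ← hW]
  set P := diagonal ((RCLike.ofReal : ℝ → ℂ) ∘ f ∘ hρ.eigenvalues)
  set Q := diagonal ((RCLike.ofReal : ℝ → ℂ) ∘ g ∘ hσ.eigenvalues)
  have h : (U * P * star U * (W * Q * star W)).trace
      = (P * (star (star W * U) * (Q * (star W * U)))).trace := by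
    rw [star_mul, star_star, mul_assoc U, mul_assoc U, trace_mul_comm U]
    simp only [mul_assoc]
  rw [h, trace, Complex.re_sum, Fintype.sum_prod_type]
  refine Finset.sum_congr rfl fun i _ => ?_
  rw [diag_apply, diagonal_mul, mul_apply, Finset.mul_sum, Complex.re_sum]
  refine Finset.sum_congr rfl fun j _ => ?_
  rw [diagonal_mul, star_apply, overlap]
  simp only [Function.comp_apply]
  set z := (star W * U) j i
  rw [show ((RCLike.ofReal (f (hρ.eigenvalues i)) : ℂ)) = ((f (hρ.eigenvalues i) : ℝ) : ℂ) from rfl,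
    show ((RCLike.ofReal (g (hσ.eigenvalues j)) : ℂ)) = ((g (hσ.eigenvalues j) : ℝ) : ℂ) from rfl]
  rw [show star z * (((g (hσ.eigenvalues j) : ℝ) : ℂ) * z) =
    ((g (hσ.eigenvalues j) * Complex.normSq z : ℝ) : ℂ) by
      rw [Complex.ofReal_mul, Complex.normSq_eq_conj_mul_self, Complex.star_def]; ring]
  rw [← Complex.ofReal_mul, Complex.ofReal_re]
  ring

/-- The quadratic functional whose supremum over `Z` is a resolvent quasi-entropy. -/
noncomputable def quasiFunctional (t : ℝ) (ρ σ Z : Matrix X X ℂ) : ℝ :=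
  2 * (Zᴴ * ρ).trace.re - (Z * Zᴴ * σ).trace.re - t * (Zᴴ * Z * ρ).trace.re

/-- In coordinates relative to the two eigenbases the functional decouples into one scalar quadratic
for each pair of eigenvalues. -/
theorem quasiFunctional_eq {ρ σ : Matrix X X ℂ} (hρ : ρ.IsHermitian) (hσ : σ.IsHermitian)
    (t : ℝ) (z : Matrix X X ℂ) :
    quasiFunctional t ρ σ
        ((hσ.eigenvectorUnitary : Matrix X X ℂ) * z * star (hρ.eigenvectorUnitary : Matrix X X ℂ)) =
      ∑ ij : X × X, (2 * hρ.eigenvalues ij.1 *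
        (star (z ij.2 ij.1) * (star (hσ.eigenvectorUnitary : Matrix X X ℂ) *
          hρ.eigenvectorUnitary) ij.2 ij.1).re
        - (hσ.eigenvalues ij.2 + t * hρ.eigenvalues ij.1) * Complex.normSq (z ij.2 ij.1)) := by
  set U := (hρ.eigenvectorUnitary : Matrix X X ℂ) with hU
  set W := (hσ.eigenvectorUnitary : Matrix X X ℂ) with hW
  have hU1 : star U * U = 1 := Unitary.coe_star_mul_self _
  have hW1 : star W * W = 1 := Unitary.coe_star_mul_self _
  have hρ' : ρ = U * diagonal ((RCLike.ofReal : ℝ → ℂ) ∘ hρ.eigenvalues) * star U := by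
    conv_lhs => rw [hρ.spectral_theorem, Unitary.conjStarAlgAut_apply]
  have hσ' : σ = W * diagonal ((RCLike.ofReal : ℝ → ℂ) ∘ hσ.eigenvalues) * star W := by
    conv_lhs => rw [hσ.spectral_theorem, Unitary.conjStarAlgAut_apply]
  have e1 : ((W * z * star U)ᴴ * ρ).trace
      = (diagonal ((RCLike.ofReal : ℝ → ℂ) ∘ hρ.eigenvalues) * (star z * (star W * U))).trace := by
    nth_rewrite 1 [hρ']
    simp only [← star_eq_conjTranspose, star_mul, star_star, mul_assoc]
    rw [trace_mul_comm]
    simp only [mul_assoc, hU1, mul_one]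
    rw [← mul_assoc, ← mul_assoc, trace_mul_comm]
    simp only [mul_assoc]
  have e2 : ((W * z * star U) * (W * z * star U)ᴴ * σ).trace
      = (diagonal ((RCLike.ofReal : ℝ → ℂ) ∘ hσ.eigenvalues) * (z * star z)).trace := by
    nth_rewrite 1 [hσ']
    simp only [← star_eq_conjTranspose, star_mul, star_star, mul_assoc]
    rw [trace_mul_comm]
    simp only [mul_assoc, hW1, mul_one]
    rw [← mul_assoc (star U) U, hU1, one_mul, ← mul_assoc (star W) W, hW1, one_mul, ← mul_assoc,
      trace_mul_comm]
  have e3 : ((W * z * star U)ᴴ * (W * z * star U) * ρ).trace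
      = (diagonal ((RCLike.ofReal : ℝ → ℂ) ∘ hρ.eigenvalues) * (star z * z)).trace := by
    nth_rewrite 1 [hρ']
    simp only [← star_eq_conjTranspose, star_mul, star_star, mul_assoc]
    rw [trace_mul_comm]
    simp only [mul_assoc, hU1, mul_one]
    rw [← mul_assoc (star W) W, hW1, one_mul, ← mul_assoc (star U) U, hU1, one_mul, ← mul_assoc,
      trace_mul_comm]
  rw [quasiFunctional, e1, e2, e3]
  have s1 : (diagonal ((RCLike.ofReal : ℝ → ℂ) ∘ hρ.eigenvalues) *
      (star z * (star W * U))).trace.re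
      = ∑ ij : X × X, hρ.eigenvalues ij.1 * (star (z ij.2 ij.1) * (star W * U) ij.2 ij.1).re := by
    rw [trace, Complex.re_sum, Fintype.sum_prod_type]
    refine Finset.sum_congr rfl fun i _ => ?_
    rw [diag_apply, diagonal_mul, mul_apply, Finset.mul_sum, Complex.re_sum]
    refine Finset.sum_congr rfl fun j _ => ?_
    exact Complex.re_ofReal_mul _ _
  have s2 : (diagonal ((RCLike.ofReal : ℝ → ℂ) ∘ hσ.eigenvalues) * (z * star z)).trace.re
      = ∑ ij : X × X, hσ.eigenvalues ij.2 * Complex.normSq (z ij.2 ij.1) := by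
    rw [trace, Complex.re_sum, Fintype.sum_prod_type_right]
    refine Finset.sum_congr rfl fun i _ => ?_
    rw [diag_apply, diagonal_mul, mul_apply, Finset.mul_sum, Complex.re_sum]
    refine Finset.sum_congr rfl fun j _ => ?_
    rw [star_apply, Complex.star_def, Complex.mul_conj]
    exact (Complex.re_ofReal_mul _ _).trans (by rw [Complex.ofReal_re]; rfl)
  have s3 : (diagonal ((RCLike.ofReal : ℝ → ℂ) ∘ hρ.eigenvalues) * (star z * z)).trace.re
      = ∑ ij : X × X, hρ.eigenvalues ij.1 * Complex.normSq (z ij.2 ij.1) := by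
    rw [trace, Complex.re_sum, Fintype.sum_prod_type]
    refine Finset.sum_congr rfl fun i _ => ?_
    rw [diag_apply, diagonal_mul, mul_apply, Finset.mul_sum, Complex.re_sum]
    refine Finset.sum_congr rfl fun j _ => ?_
    rw [star_apply, Complex.star_def, ← Complex.normSq_eq_conj_mul_self]
    exact (Complex.re_ofReal_mul _ _).trans (by rw [Complex.ofReal_re]; rfl)
  rw [s1, s2, s3, Finset.mul_sum, Finset.mul_sum, ← Finset.sum_sub_distrib,
    ← Finset.sum_sub_distrib]
  refine Finset.sum_congr rfl fun ij _ => ?_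
  ring

/-- The resolvent quasi-entropy of two Hermitian matrices in terms of their eigenvalues. -/
noncomputable def quasiEntropy {ρ σ : Matrix X X ℂ} (hρ : ρ.IsHermitian) (hσ : σ.IsHermitian)
    (t : ℝ) : ℝ :=
  ∑ ij : X × X, hρ.eigenvalues ij.1 * overlap hρ hσ ij /
    (hσ.eigenvalues ij.2 / hρ.eigenvalues ij.1 + t)

/-- With eigenvalues `p`, `q` and overlap amplitude `c`, completing the square bounds `2p Re(z̄c) -
(q + tp)|z|²` by `p²|c|²/(q + tp)`. -/
theorem quasiFunctional_le {ρ σ : Matrix X X ℂ} (hρ : ρ.PosDef) (hσ : σ.PosDef)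
    {t : ℝ} (ht : 0 ≤ t) (Z : Matrix X X ℂ) :
    quasiFunctional t ρ σ Z ≤ quasiEntropy hρ.isHermitian hσ.isHermitian t := by
  set U := (hρ.isHermitian.eigenvectorUnitary : Matrix X X ℂ) with hU
  set W := (hσ.isHermitian.eigenvectorUnitary : Matrix X X ℂ) with hW
  have hZ : Z = W * (star W * Z * U) * star U := by
    have hU1 : U * star U = 1 := Unitary.coe_mul_star_self _
    have hW1 : W * star W = 1 := Unitary.coe_mul_star_self _
    simp only [mul_assoc, hU1, mul_one]
    rw [← mul_assoc, hW1, one_mul]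
  rw [hZ, quasiFunctional_eq, quasiEntropy]
  refine Finset.sum_le_sum fun ij _ => ?_
  have hp := hρ.eigenvalues_pos ij.1
  have hq := hσ.eigenvalues_pos ij.2
  rw [overlap]
  set p := hρ.isHermitian.eigenvalues ij.1
  set q := hσ.isHermitian.eigenvalues ij.2
  set z := (star W * Z * U) ij.2 ij.1
  rw [← hU, ← hW]
  set c := (star W * U) ij.2 ij.1
  have hr : 0 < q + t * p := by positivity
  have e : p * Complex.normSq c / (q / p + t) = p ^ 2 * Complex.normSq c / (q + t * p) := by
    field_simp
  rw [e, le_div_iff₀ hr]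
  simp only [Complex.normSq_apply, Complex.star_def, Complex.mul_re, Complex.conj_re,
    Complex.conj_im]
  nlinarith [sq_nonneg (p * c.re - (q + t * p) * z.re), sq_nonneg (p * c.im - (q + t * p) * z.im)]

theorem exists_quasiFunctional_eq {ρ σ : Matrix X X ℂ} (hρ : ρ.PosDef) (hσ : σ.PosDef)
    {t : ℝ} (ht : 0 ≤ t) :
    ∃ Z, quasiFunctional t ρ σ Z = quasiEntropy hρ.isHermitian hσ.isHermitian t := by
  set U := (hρ.isHermitian.eigenvectorUnitary : Matrix X X ℂ) with hU
  set W := (hσ.isHermitian.eigenvectorUnitary : Matrix X X ℂ) with hW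
  -- The coordinates `z = pc/(q + tp)` are where each completed square vanishes.
  refine ⟨_, (quasiFunctional_eq hρ.isHermitian hσ.isHermitian t (Matrix.of fun j i =>
    ((hρ.isHermitian.eigenvalues i / (hσ.isHermitian.eigenvalues j
      + t * hρ.isHermitian.eigenvalues i) : ℝ) : ℂ) * (star W * U) j i)).trans ?_⟩
  rw [quasiEntropy]
  refine Finset.sum_congr rfl fun ij _ => ?_
  have hp := hρ.eigenvalues_pos ij.1
  have hq := hσ.eigenvalues_pos ij.2
  rw [overlap, of_apply, ← hU, ← hW]
  set p := hρ.isHermitian.eigenvalues ij.1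
  set q := hσ.isHermitian.eigenvalues ij.2
  set c := (star W * U) ij.2 ij.1
  have hr : 0 < q + t * p := by positivity
  have e1 : (star (((p / (q + t * p) : ℝ) : ℂ) * c) * c).re
      = p / (q + t * p) * Complex.normSq c := by
    rw [star_mul', Complex.star_def, Complex.conj_ofReal, mul_assoc,
      ← Complex.normSq_eq_conj_mul_self, Complex.re_ofReal_mul, Complex.ofReal_re]
  rw [e1, Complex.normSq_mul, Complex.normSq_ofReal]
  field_simp
  ring

/-- Umegaki relative entropy `Tr ρ (log₂ ρ - log₂ σ)`. -/
noncomputable def relEntropy (ρ σ : Matrix X X ℂ) : ℝ :=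
  -entropy ρ - (ρ * cfc (Real.logb 2) σ).trace.re

theorem relEntropy_eq {ρ σ : Matrix X X ℂ} (hρ : ρ.PosDef) (hσ : σ.PosDef) :
    relEntropy ρ σ = -(∑ ij : X × X, hρ.isHermitian.eigenvalues ij.1 *
      overlap hρ.isHermitian hσ.isHermitian ij *
      Real.log (hσ.isHermitian.eigenvalues ij.2 / hρ.isHermitian.eigenvalues ij.1)) /
        Real.log 2 := by
  have h1 := trace_cfc_mul_cfc hρ.isHermitian hσ.isHermitian (fun x => x) (Real.logb 2)
  rw [cfc_id' ℝ ρ hρ.isHermitian.isSelfAdjoint] at h1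
  have h2 := trace_cfc_mul_cfc hρ.isHermitian hσ.isHermitian
    (fun x => Real.negMulLog x / Real.log 2) (fun _ => 1)
  rw [cfc_const_one ℝ σ hσ.isHermitian.isSelfAdjoint, mul_one,
    ← entropy_eq_trace_cfc hρ.isHermitian] at h2
  rw [relEntropy, h1, h2, ← Finset.sum_neg_distrib, ← Finset.sum_sub_distrib,
    ← Finset.sum_neg_distrib, Finset.sum_div]
  refine Finset.sum_congr rfl fun ij _ => ?_
  rw [Real.log_div (hσ.eigenvalues_pos _).ne' (hρ.eigenvalues_pos _).ne', Real.negMulLog, Real.logb]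
  ring

theorem sum_eigenvalues_mul_overlap {ρ σ : Matrix X X ℂ} (hρ : ρ.IsHermitian)
    (hσ : σ.IsHermitian) :
    ∑ ij : X × X, hρ.eigenvalues ij.1 * overlap hρ hσ ij = ρ.trace.re := by
  have h := trace_cfc_mul_cfc hρ hσ (fun x => x) (fun _ => 1)
  rw [cfc_const_one ℝ σ hσ.isSelfAdjoint, cfc_id' ℝ ρ hρ.isSelfAdjoint, mul_one] at h
  simpa using h.symm

theorem trace_kronecker_one_mul (M : Matrix X X ℂ) (ρ : Matrix (X × Y) (X × Y) ℂ) :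
    ((M ⊗ₖ (1 : Matrix Y Y ℂ)) * ρ).trace = (M * traceRight ρ).trace := by
  simp only [trace, diag_apply, mul_apply, Fintype.sum_prod_type, kroneckerMap_apply, traceRight,
    of_apply, one_apply, mul_ite, mul_one, mul_zero, ite_mul, zero_mul, Finset.sum_ite_eq,
    Finset.mem_univ, if_true, Finset.mul_sum]
  exact Finset.sum_congr rfl fun i _ => Finset.sum_comm

theorem trace_traceRight (ρ : Matrix (X × Y) (X × Y) ℂ) : (traceRight ρ).trace = ρ.trace := by
  simp [trace, traceRight, Fintype.sum_prod_type]

theorem traceRight_eq_sum (ρ : Matrix (X × Y) (X × Y) ℂ) :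
    traceRight ρ = ∑ y, ρ.submatrix (fun x => (x, y)) (fun x => (x, y)) := by
  ext x x'
  simp [traceRight, Matrix.sum_apply]

theorem posSemidef_traceRight {ρ : Matrix (X × Y) (X × Y) ℂ} (hρ : ρ.PosSemidef) :
    (traceRight ρ).PosSemidef := by
  rw [traceRight_eq_sum]
  exact posSemidef_sum _ fun y _ => hρ.submatrix _

theorem posDef_traceRight [Nonempty Y] {ρ : Matrix (X × Y) (X × Y) ℂ} (hρ : ρ.PosDef) :
    (traceRight ρ).PosDef := by
  rw [traceRight_eq_sum]
  exact posDef_sum Finset.univ_nonempty fun y _ => hρ.submatrix (Prod.mk_left_injective y)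

/-- Evaluating the functional of `ρ, σ` at `Z ⊗ 1` gives the functional of the marginals at `Z`. The
supremum for the marginals is therefore no larger, for every `t ≥ 0`, and the resolvent comparison
passes to logarithms. -/
theorem relEntropy_traceRight_le [Nonempty Y] {ρ σ : Matrix (X × Y) (X × Y) ℂ} (hρ : ρ.PosDef)
    (hσ : σ.PosDef) : relEntropy (traceRight ρ) (traceRight σ) ≤ relEntropy ρ σ := by
  have hρ' := posDef_traceRight hρ
  have hσ' := posDef_traceRight hσ
  rw [relEntropy_eq hρ hσ, relEntropy_eq hρ' hσ']
  refine div_le_div_of_nonneg_right (neg_le_neg ?_) (Real.log_nonneg one_le_two)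
  refine sum_mul_log_le_of_resolvent_le _ _ _ _
    (fun ij => div_pos (hσ.eigenvalues_pos _) (hρ.eigenvalues_pos _))
    (fun ij => div_pos (hσ'.eigenvalues_pos _) (hρ'.eigenvalues_pos _)) ?_ fun t ht => ?_
  · rw [sum_eigenvalues_mul_overlap, sum_eigenvalues_mul_overlap, trace_traceRight]
  · obtain ⟨Z, hZ⟩ := exists_quasiFunctional_eq hρ' hσ' ht
    have h := quasiFunctional_le hρ hσ ht (Z ⊗ₖ (1 : Matrix Y Y ℂ))
    have e : quasiFunctional t ρ σ (Z ⊗ₖ (1 : Matrix Y Y ℂ))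
        = quasiFunctional t (traceRight ρ) (traceRight σ) Z := by
      simp only [quasiFunctional, conjTranspose_kronecker, conjTranspose_one,
        ← mul_kronecker_mul, mul_one, trace_kronecker_one_mul]
    rw [e, hZ] at h
    exact h

/-- The Holevo quantity of an unnormalised ensemble; the traces of the `τ i` carry the
probabilities. -/
theorem sum_relEntropy {ι : Type*} [Fintype ι] (τ : ι → Matrix X X ℂ) :
    ∑ i, relEntropy (τ i) (∑ i, τ i) = entropy (∑ i, τ i) - ∑ i, entropy (τ i) := by
  simp only [relEntropy, Finset.sum_sub_distrib, Finset.sum_neg_distrib]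
  rw [← Complex.re_sum, ← trace_sum, ← Finset.sum_mul]
  simp only [entropy]
  ring

theorem traceRight_sum {ι : Type*} [Fintype ι] (τ : ι → Matrix (X × Y) (X × Y) ℂ) :
    traceRight (∑ i, τ i) = ∑ i, traceRight (τ i) := by
  ext x x'
  simp only [traceRight, of_apply, Matrix.sum_apply]
  exact Finset.sum_comm

theorem continuous_traceRight :
    Continuous (traceRight : Matrix (X × Y) (X × Y) ℂ → Matrix X X ℂ) := by
  refine continuous_matrix fun x x' => ?_
  simp only [traceRight, of_apply]
  fun_prop

open Filter Topology in
theorem tendsto_entropy {F : ℝ → Matrix X X ℂ} (hF : Continuous F)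
    (hp : ∀ ε, 0 ≤ ε → (F ε).PosSemidef) :
    Tendsto (fun ε => entropy (F ε)) (𝓝[>] 0) (𝓝 (entropy (F 0))) := by
  have h : ContinuousWithinAt (fun ε => entropy (F ε)) (Set.Ici 0) 0 :=
    (continuousOn_entropy.comp hF.continuousOn hp) 0 (Set.mem_Ici.2 le_rfl)
  exact h.mono_left (nhdsWithin_mono _ Set.Ioi_subset_Ici_self)

open Filter Topology in
/-- Monotonicity of the Holevo quantity under partial trace. -/
theorem entropy_traceRight_sub_sum_le [Nonempty Y] {ι : Type*} [Fintype ι]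
    {τ : ι → Matrix (X × Y) (X × Y) ℂ} (hτ : ∀ i, (τ i).PosSemidef) :
    entropy (traceRight (∑ i, τ i)) - ∑ i, entropy (traceRight (τ i)) ≤
      entropy (∑ i, τ i) - ∑ i, entropy (τ i) := by
  -- An empty sum is not positive definite in general, so the perturbation argument below needs a
  -- nonempty family.
  rcases isEmpty_or_nonempty ι with hι | hι
  · have h : traceRight (0 : Matrix (X × Y) (X × Y) ℂ) = 0 := by ext; simp [traceRight]
    simp [h, entropy]
  -- Adding `ε • 1` reaches the positive definite case; continuity of the entropy lets `ε` tend to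
  -- `0`.
  have hpd : ∀ ε : ℝ, 0 < ε → ∀ i, (τ i + (ε : ℂ) • 1).PosDef := fun ε hε i =>
    PosDef.posSemidef_add (hτ i) (PosDef.one.smul (by exact_mod_cast hε))
  have hle : ∀ ε : ℝ, 0 < ε →
      entropy (traceRight (∑ i, (τ i + (ε : ℂ) • 1)))
        - ∑ i, entropy (traceRight (τ i + (ε : ℂ) • 1)) ≤
      entropy (∑ i, (τ i + (ε : ℂ) • 1)) - ∑ i, entropy (τ i + (ε : ℂ) • 1) := by
    intro ε hε
    rw [← sum_relEntropy, traceRight_sum, ← sum_relEntropy (fun i => traceRight _),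
      ← traceRight_sum]
    exact Finset.sum_le_sum fun i _ => relEntropy_traceRight_le (hpd ε hε i)
      (posDef_sum Finset.univ_nonempty fun i _ => hpd ε hε i)
  have hps : ∀ ε : ℝ, 0 ≤ ε → ∀ i, (τ i + (ε : ℂ) • 1).PosSemidef := fun ε hε i =>
    (hτ i).add (PosSemidef.one.smul (by exact_mod_cast hε))
  have hc : ∀ i, Continuous fun ε : ℝ => τ i + (ε : ℂ) • (1 : Matrix (X × Y) (X × Y) ℂ) := by
    intro i; fun_prop
  have hcs : Continuous fun ε : ℝ => ∑ i, (τ i + (ε : ℂ) • (1 : Matrix (X × Y) (X × Y) ℂ)) :=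
    continuous_finsetSum _ fun i _ => hc i
  have hpss := fun ε hε => posSemidef_sum Finset.univ fun i _ => hps ε hε i
  have l1 := tendsto_entropy (continuous_traceRight.comp hcs) fun ε hε => posSemidef_traceRight (hpss ε hε)
  have l2 := fun i => tendsto_entropy (continuous_traceRight.comp (hc i))
    fun ε hε => posSemidef_traceRight (hps ε hε i)
  have l3 := tendsto_entropy hcs hpss
  have l4 := fun i => tendsto_entropy (hc i) fun ε hε => hps ε hε i
  have := le_of_tendsto_of_tendsto (l1.sub (tendsto_finsetSum Finset.univ fun i _ => l2 i))
    (l3.sub (tendsto_finsetSum Finset.univ fun i _ => l4 i))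
    (by filter_upwards [self_mem_nhdsWithin] with ε hε using hle ε hε)
  simpa using this

end RelativeEntropy

/-! ### Conditional states, concavity and rank-one refinement. -/

section Conditioning

set_option linter.unusedSectionVars false

/-- The positively homogeneous extension `t S(M / t)`, `t = Tr M`, of the entropy of states. -/
noncomputable def scaledEntropy (M : Matrix X X ℂ) : ℝ :=
  entropy M + M.trace.re * Real.logb 2 M.trace.re

theorem posSemidef_trace_eq_re {M : Matrix X X ℂ} (hM : M.PosSemidef) :
    M.trace = (M.trace.re : ℂ) :=
  Complex.ext rfl (by simpa using (Complex.le_def.1 hM.trace_nonneg).2.symm)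

theorem posSemidef_trace_re_nonneg {M : Matrix X X ℂ} (hM : M.PosSemidef) : 0 ≤ M.trace.re :=
  (Complex.le_def.1 hM.trace_nonneg).1

theorem scaledEntropy_zero : scaledEntropy (0 : Matrix X X ℂ) = 0 := by
  simp [scaledEntropy, entropy]

theorem scaledEntropy_smul {M : Matrix X X ℂ} (hM : M.IsHermitian) (t : ℝ) :
    scaledEntropy ((t : ℂ) • M) = t * scaledEntropy M := by
  rw [scaledEntropy, scaledEntropy, entropy_smul hM, trace_smul, smul_eq_mul,
    Complex.re_ofReal_mul]
  rcases eq_or_ne t 0 with rfl | ht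
  · simp
  rcases eq_or_ne M.trace.re 0 with hm | hm
  · simp [hm]
  rw [Real.logb_mul ht hm]
  ring

theorem continuousOn_scaledEntropy :
    ContinuousOn (scaledEntropy (X := X)) {M | M.PosSemidef} := by
  have h : Continuous fun M : Matrix X X ℂ => M.trace.re * Real.logb 2 M.trace.re := by
    have h1 : Continuous fun M : Matrix X X ℂ => M.trace.re :=
      Complex.continuous_re.comp continuous_id.matrix_trace
    have h2 : Continuous fun x : ℝ => x * Real.logb 2 x := by
      have := Real.continuous_mul_log.div_const (Real.log 2)
      exact this.congr fun x => by rw [Real.logb]; ring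
    exact h2.comp h1
  exact continuousOn_entropy.add h.continuousOn

theorem entropy_reindex {M : Matrix X X ℂ} (hM : M.IsHermitian) (e : X ≃ Y) :
    entropy (reindex e e M) = entropy M := by
  have h : (reindex e e M).IsHermitian := hM.submatrix _
  rw [entropy_eq_sum_roots hM, entropy_eq_sum_roots h, charpoly_reindex]

theorem entropy_unique [Unique X] {M : Matrix X X ℂ} (hM : M.IsHermitian) :
    entropy M = - (M.trace.re * Real.logb 2 M.trace.re) := by
  have h := hM.trace_eq_sum_eigenvalues
  rw [entropy_eq_sum_eigenvalues hM, h]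
  simp [Real.negMulLog, Real.logb]
  ring

/-- This is Holevo monotonicity with all of `X` traced out: on `Unit × X` the marginal is the `1 ×
1` matrix of the trace, whose entropy `-t log₂ t` is the correction term in `scaledEntropy`. -/
theorem sum_scaledEntropy_le {ι : Type*} [Fintype ι] {τ : ι → Matrix X X ℂ}
    (hτ : ∀ i, (τ i).PosSemidef) :
    ∑ i, scaledEntropy (τ i) ≤ scaledEntropy (∑ i, τ i) := by
  rcases isEmpty_or_nonempty X with hX | hX
  · have : ∀ M : Matrix X X ℂ, M = 0 := fun M => Subsingleton.elim _ _
    rw [this (∑ i, τ i)]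
    simp [this (τ _), scaledEntropy_zero]
  let e : X ≃ Unit × X := (Equiv.uniqueProd X Unit).symm
  have hs : reindex e e (∑ i, τ i) = ∑ i, reindex e e (τ i) := by
    ext; simp [Matrix.sum_apply]
  have hp : ∀ M : Matrix X X ℂ, M.PosSemidef → (reindex e e M).PosSemidef :=
    fun M hM => hM.submatrix _
  have ht : ∀ M : Matrix X X ℂ, M.PosSemidef →
      entropy (traceRight (reindex e e M)) = -(M.trace.re * Real.logb 2 M.trace.re) := by
    intro M hM
    have h : (traceRight (reindex e e M)).trace = M.trace := by
      rw [trace_traceRight]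
      exact Fintype.sum_equiv e.symm _ _ fun _ => rfl
    rw [entropy_unique (posSemidef_traceRight (hp M hM)).isHermitian, h]
  have hS := posSemidef_sum Finset.univ fun i _ => hτ i
  have h := entropy_traceRight_sub_sum_le fun i => hp _ (hτ i)
  rw [← hs, ht _ hS, entropy_reindex hS.isHermitian] at h
  simp only [ht _ (hτ _), entropy_reindex (hτ _).isHermitian, Finset.sum_neg_distrib] at h
  simp only [scaledEntropy, Finset.sum_add_distrib]
  linarith

/-- The unnormalised conditional state `Tr_B ((1 ⊗ F) ρ)`. -/
noncomputable def conditioned (ρ : Matrix (A × B) (A × B) ℂ) (F : Matrix B B ℂ) : Matrix A A ℂ :=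
  traceRight (((1 : Matrix A A ℂ) ⊗ₖ F) * ρ)

theorem conditioned_apply (ρ : Matrix (A × B) (A × B) ℂ) (F : Matrix B B ℂ) (a a' : A) :
    conditioned ρ F a a' = ∑ y, ∑ b, F y b * ρ (a, b) (a', y) := by
  simp only [conditioned, traceRight, of_apply, mul_apply, Fintype.sum_prod_type,
    kroneckerMap_apply, one_apply, ite_mul, one_mul, zero_mul]
  refine Finset.sum_congr rfl fun y _ => ?_
  rw [Finset.sum_comm]
  simp

theorem traceRight_one_kronecker_mul_comm (G : Matrix B B ℂ) (N : Matrix (A × B) (A × B) ℂ) :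
    traceRight (((1 : Matrix A A ℂ) ⊗ₖ G) * N) = traceRight (N * ((1 : Matrix A A ℂ) ⊗ₖ G)) := by
  ext a a'
  rw [← conditioned, conditioned_apply]
  simp only [traceRight, of_apply, mul_apply, Fintype.sum_prod_type,
    kroneckerMap_apply, one_apply, ite_mul, one_mul, zero_mul, mul_ite, mul_zero]
  rw [Finset.sum_comm]
  refine Finset.sum_congr rfl fun y _ => ?_
  rw [Finset.sum_comm]
  simp [mul_comm]

theorem exists_eq_conjTranspose_mul_self {M : Matrix X X ℂ} (hM : M.PosSemidef) :
    ∃ G : Matrix X X ℂ, M = Gᴴ * G := by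
  open scoped MatrixOrder in
  exact (CStarAlgebra.nonneg_iff_eq_star_mul_self).1 hM.nonneg

theorem posSemidef_conditioned {ρ : Matrix (A × B) (A × B) ℂ} (hρ : ρ.PosSemidef)
    {F : Matrix B B ℂ} (hF : F.PosSemidef) : (conditioned ρ F).PosSemidef := by
  obtain ⟨G, rfl⟩ := exists_eq_conjTranspose_mul_self hF
  have h : (1 : Matrix A A ℂ) ⊗ₖ (Gᴴ * G) = ((1 : Matrix A A ℂ) ⊗ₖ Gᴴ) * (1 ⊗ₖ G) := by
    rw [← mul_kronecker_mul, mul_one]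
  rw [conditioned, h, mul_assoc, traceRight_one_kronecker_mul_comm]
  have h2 : ((1 : Matrix A A ℂ) ⊗ₖ Gᴴ) = ((1 : Matrix A A ℂ) ⊗ₖ G)ᴴ := by
    rw [conjTranspose_kronecker, conjTranspose_one]
  rw [h2]
  exact posSemidef_traceRight (hρ.mul_mul_conjTranspose_same _)

theorem conditioned_sum {ι : Type*} [Fintype ι] (ρ : Matrix (A × B) (A × B) ℂ)
    (F : ι → Matrix B B ℂ) : conditioned ρ (∑ i, F i) = ∑ i, conditioned ρ (F i) := by
  ext a a'
  simp only [conditioned_apply, Matrix.sum_apply, Finset.sum_mul]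
  refine Eq.trans ?_ Finset.sum_comm
  exact Finset.sum_congr rfl fun y _ => Finset.sum_comm

theorem conditioned_smul (ρ : Matrix (A × B) (A × B) ℂ) (c : ℂ) (F : Matrix B B ℂ) :
    conditioned ρ (c • F) = c • conditioned ρ F := by
  ext a a'
  simp only [conditioned_apply, Matrix.smul_apply, smul_eq_mul, Finset.mul_sum, mul_assoc]

theorem conditioned_one (ρ : Matrix (A × B) (A × B) ℂ) : conditioned ρ 1 = traceRight ρ := by
  rw [conditioned, one_kronecker_one, one_mul]

theorem continuous_conditioned (ρ : Matrix (A × B) (A × B) ℂ) : Continuous (conditioned ρ) := by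
  refine continuous_matrix fun a a' => ?_
  simp only [conditioned_apply]
  fun_prop

/-- If the probability vanishes, the positive operator `conditioned ρ F` has trace zero and is zero,
so both sides vanish. Otherwise this is the scaling law of the entropy. -/
theorem outcomeProb_mul_entropy_postState {ρ : Matrix (A × B) (A × B) ℂ} (hρ : ρ.PosSemidef)
    {F : Matrix B B ℂ} (hF : F.PosSemidef) :
    outcomeProb F ρ * entropy (postState F ρ) = scaledEntropy (conditioned ρ F) := by
  have hM := posSemidef_conditioned hρ hF
  have hp : outcomeProb F ρ = (conditioned ρ F).trace.re := by
    rw [outcomeProb, conditioned, trace_traceRight]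
  rw [postState, ← conditioned, ← Complex.ofReal_inv, entropy_smul hM.isHermitian, hp,
    scaledEntropy]
  rcases eq_or_ne (conditioned ρ F).trace.re 0 with h | h
  · have h0 : conditioned ρ F = 0 := by
      rw [← hM.trace_eq_zero_iff, posSemidef_trace_eq_re hM, h, Complex.ofReal_zero]
    simp [h0, entropy]
  · rw [Real.logb_inv]
    field_simp
    ring

theorem measurementGain_eq {ρ : Matrix (A × B) (A × B) ℂ} (hρ : ρ.PosSemidef) {n : ℕ}
    {E : Fin n → Matrix B B ℂ} (hE : IsPOVM E) :
    measurementGain ρ E = entropy (traceRight ρ) - ∑ i, scaledEntropy (conditioned ρ (E i)) := by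
  rw [measurementGain]
  congr 1
  exact Finset.sum_congr rfl fun i _ => outcomeProb_mul_entropy_postState hρ (hE.1 i)

/-- Every measurement can be refined to one with rank one effects, without decreasing the gain. -/
theorem exists_rankOne_refinement {n : ℕ} {E : Fin n → Matrix B B ℂ} (hE : IsPOVM E) :
    ∃ (m : ℕ) (v : Fin m → B → ℂ), IsPOVM (fun i => vecMulVec (v i) (star (v i))) ∧
      ∀ ρ : Matrix (A × B) (A × B) ℂ, ρ.PosSemidef →
        measurementGain ρ E ≤ measurementGain ρ fun i => vecMulVec (v i) (star (v i)) := by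
  choose G hG using fun i => exists_eq_conjTranspose_mul_self (hE.1 i)
  let e := Fintype.equivFin (Fin n × B)
  -- The conjugated rows of `G i` split `E i = (G i)ᴴ * G i` into rank-one terms.
  let u : Fin n × B → B → ℂ := fun ik b => star (G ik.1 ik.2 b)
  have hu : ∀ i, ∑ k, vecMulVec (u (i, k)) (star (u (i, k))) = E i := by
    intro i
    ext b b'
    rw [hG, mul_apply, Matrix.sum_apply]
    simp [vecMulVec_apply, u]
  have hP : IsPOVM (fun i => vecMulVec (u (e.symm i)) (star (u (e.symm i)))) := by
    refine ⟨fun i => posSemidef_vecMulVec_self_star _, ?_⟩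
    rw [e.symm.sum_comp (fun ik => vecMulVec (u ik) (star (u ik))), Fintype.sum_prod_type, ← hE.2]
    exact Finset.sum_congr rfl fun i _ => hu i
  refine ⟨_, fun i => u (e.symm i), hP, fun ρ hρ => ?_⟩
  rw [measurementGain_eq hρ hE, measurementGain_eq hρ hP,
    e.symm.sum_comp (fun ik => scaledEntropy (conditioned ρ (vecMulVec (u ik) (star (u ik))))),
    Fintype.sum_prod_type]
  refine sub_le_sub_left (Finset.sum_le_sum fun i _ => ?_) _
  rw [← hu i, conditioned_sum]
  exact sum_scaledEntropy_le fun k =>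
    posSemidef_conditioned hρ (posSemidef_vecMulVec_self_star _)

end Conditioning

/-! ### Existence of optimal measurements. -/

section Attainment

/-- By Carathéodory, `finrank + 1` points suffice, so the hull is a continuous image of a simplex
times a power of `s`. -/
theorem isCompact_convexHull {E : Type*} [AddCommGroup E] [Module ℝ E] [TopologicalSpace E]
    [ContinuousAdd E] [ContinuousSMul ℝ E] [FiniteDimensional ℝ E] {s : Set E}
    (hs : IsCompact s) : IsCompact (convexHull ℝ s) := by
  rcases s.eq_empty_or_nonempty with rfl | ⟨x₀, hx₀⟩
  · simp
  set N := Module.finrank ℝ E + 1 with hN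
  have h : convexHull ℝ s = (fun p : (Fin N → ℝ) × (Fin N → E) => ∑ i, p.1 i • p.2 i) ''
      (stdSimplex ℝ (Fin N) ×ˢ Set.univ.pi fun _ => s) := by
    refine Set.Subset.antisymm (fun x hx => ?_) ?_
    · obtain ⟨ι, _, z, w, hz, hai, hw, hw1, hx⟩ := eq_pos_convex_span_of_mem_convexHull hx
      classical
      have hc : Fintype.card ι ≤ Fintype.card (Fin N) := by
        rw [Fintype.card_fin]
        exact hai.card_le_finrank_succ.trans (Nat.succ_le_succ (Submodule.finrank_le _))
      obtain ⟨f⟩ := Function.Embedding.nonempty_of_card_le hc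
      -- Shorter combinations are padded with weight zero at the dummy point `x₀`.
      refine ⟨(Function.extend f w 0, Function.extend f z fun _ => x₀), ⟨⟨fun j => ?_, ?_⟩, ?_⟩, ?_⟩
      · by_cases hj : ∃ i, f i = j
        · obtain ⟨i, rfl⟩ := hj
          simpa [f.injective.extend_apply] using (hw i).le
        · simp [Function.extend_apply' _ _ _ hj]
      · rw [← hw1]
        refine (Fintype.sum_of_injective f f.injective _ _ (fun j hj => ?_) fun i => ?_).symm
        · exact Function.extend_apply' _ _ _ hj
        · exact (f.injective.extend_apply _ _ _).symm
      · intro j _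
        by_cases hj : ∃ i, f i = j
        · obtain ⟨i, rfl⟩ := hj
          simpa [f.injective.extend_apply] using hz ⟨i, rfl⟩
        · simpa [Function.extend_apply' _ _ _ hj] using hx₀
      · rw [← hx]
        refine (Fintype.sum_of_injective f f.injective _ _ (fun j hj => ?_) fun i => ?_).symm
        · simp [Function.extend_apply' _ _ _ hj]
        · simp [f.injective.extend_apply]
    · rintro _ ⟨p, ⟨hp1, hp2⟩, rfl⟩
      exact mem_convexHull_of_exists_fintype p.1 p.2 hp1.1 hp1.2 (fun i => hp2 i trivial) rfl
  rw [h]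
  refine ((isCompact_stdSimplex ℝ _).prod (isCompact_univ_pi fun _ => hs)).image ?_
  fun_prop

/-- States are the image of the Hilbert–Schmidt unit sphere under `G ↦ Gᴴ * G`. -/
theorem isCompact_setOf_isState : IsCompact {E : Matrix B B ℂ | IsState E} := by
  have h : {E : Matrix B B ℂ | IsState E} =
      (fun G : Matrix B B ℂ => Gᴴ * G) '' {G | (Gᴴ * G).trace = 1} := by
    ext E
    constructor
    · rintro ⟨h1, h2⟩
      obtain ⟨G, rfl⟩ := exists_eq_conjTranspose_mul_self h1
      exact ⟨G, h2, rfl⟩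
    · rintro ⟨G, hG, rfl⟩
      exact ⟨posSemidef_conjTranspose_mul_self G, hG⟩
  have hcont : Continuous fun G : Matrix B B ℂ => Gᴴ * G :=
    continuous_id.matrix_conjTranspose.matrix_mul continuous_id
  have htr : ∀ G : Matrix B B ℂ, (Gᴴ * G).trace.re = ∑ b, ∑ k, Complex.normSq (G k b) := by
    intro G
    simp only [trace, diag_apply, mul_apply, conjTranspose_apply, Complex.star_def,
      ← Complex.normSq_eq_conj_mul_self, Complex.re_sum, Complex.ofReal_re]
  rw [h]
  refine IsCompact.image ?_ hcont
  have hK : IsCompact (Set.univ.pi fun _ : B => Set.univ.pi fun _ : B =>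
      Metric.closedBall (0 : ℂ) 1) :=
    isCompact_univ_pi fun _ => isCompact_univ_pi fun _ => isCompact_closedBall _ _
  refine hK.of_isClosed_subset (isClosed_eq hcont.matrix_trace continuous_const) ?_
  intro G hG i _ j _
  rw [mem_closedBall_zero_iff]
  have h1 : ∑ b, ∑ k, Complex.normSq (G k b) = 1 := by
    exact (htr G).symm.trans (congrArg Complex.re hG)
  have h2 : Complex.normSq (G i j) ≤ 1 := by
    rw [← h1]
    refine le_trans ?_ (Finset.single_le_sum
      (fun b _ => Finset.sum_nonneg fun k _ => Complex.normSq_nonneg (G k b)) (Finset.mem_univ j))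
    exact Finset.single_le_sum (f := fun k => Complex.normSq (G k j))
      (fun k _ => Complex.normSq_nonneg (G k j)) (Finset.mem_univ i)
  rw [Complex.normSq_eq_norm_sq] at h2
  exact (sq_le_one_iff₀ (norm_nonneg _)).1 h2

/-- The pairs of an effect of trace one and the scaled entropy of the outcome it gives. -/
noncomputable def effectGraph (ρ : Matrix (A × B) (A × B) ℂ) : Set (Matrix B B ℂ × ℝ) :=
  (fun E => (E, scaledEntropy (conditioned ρ E))) '' {E | IsState E}

theorem isCompact_effectGraph {ρ : Matrix (A × B) (A × B) ℂ} (hρ : ρ.PosSemidef) :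
    IsCompact (effectGraph ρ) := by
  refine isCompact_setOf_isState.image_of_continuousOn (continuousOn_id.prodMk ?_)
  exact continuousOn_scaledEntropy.comp (continuous_conditioned ρ).continuousOn
    fun E hE => posSemidef_conditioned hρ hE.1

/-- The number of outcomes is unbounded, so POVMs have no evident compact parameter space. Dividing
effects by their traces turns a POVM into a convex decomposition of `1/d` into states, with weights
`Tr Eᵢ / d`. As `scaledEntropy` is homogeneous, the gain depends only on the averaged second
coordinate. -/
theorem gainSet_eq [Nonempty B] {ρ : Matrix (A × B) (A × B) ℂ} (hρ : ρ.PosSemidef) :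
    gainSet ρ = (fun p : Matrix B B ℂ × ℝ => entropy (traceRight ρ) - Fintype.card B * p.2) ''
      (convexHull ℝ (effectGraph ρ) ∩ {p | p.1 = (Fintype.card B : ℝ)⁻¹ • 1}) := by
  set d : ℝ := (Fintype.card B : ℝ) with hd
  have hd0 : 0 < d := by rw [hd]; exact_mod_cast Fintype.card_pos
  have hsm : ∀ (c : ℝ) (M : Matrix B B ℂ), c • M = (c : ℂ) • M := fun c M => by ext; simp
  have hscale : ∀ (c : ℝ) (E : Matrix B B ℂ), E.PosSemidef →
      scaledEntropy (conditioned ρ (c • E)) = c * scaledEntropy (conditioned ρ E) := by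
    intro c E hE
    rw [hsm, conditioned_smul, scaledEntropy_smul (posSemidef_conditioned hρ hE).isHermitian]
  have hpos : ∀ (c : ℝ) (E : Matrix B B ℂ), 0 ≤ c → E.PosSemidef → (c • E).PosSemidef := by
    intro c E hc hE
    rw [hsm]
    exact hE.smul (by exact_mod_cast hc)
  have hone : IsState (d⁻¹ • (1 : Matrix B B ℂ)) := by
    refine ⟨hpos _ _ (by positivity) PosSemidef.one, ?_⟩
    rw [hsm, trace_smul, trace_one, hd]
    simp
  ext x
  constructor
  · rintro ⟨n, E, hE, rfl⟩
    refine ⟨(d⁻¹ • 1, d⁻¹ * ∑ i, scaledEntropy (conditioned ρ (E i))), ⟨?_, rfl⟩, ?_⟩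
    · have hz : ∀ i, ∃ z, IsState z ∧ E i = (E i).trace.re • z := by
        intro i
        rcases eq_or_ne (E i).trace.re 0 with h | h
        · refine ⟨_, hone, ?_⟩
          rw [h, zero_smul, ← (hE.1 i).trace_eq_zero_iff, posSemidef_trace_eq_re (hE.1 i), h,
            Complex.ofReal_zero]
        · refine ⟨(E i).trace.re⁻¹ • E i,
            ⟨hpos _ _ (inv_nonneg.2 (posSemidef_trace_re_nonneg (hE.1 i))) (hE.1 i), ?_⟩,
            (smul_inv_smul₀ h _).symm⟩
          rw [hsm, trace_smul, posSemidef_trace_eq_re (hE.1 i), smul_eq_mul, Complex.ofReal_re,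
            ← Complex.ofReal_mul, inv_mul_cancel₀ h, Complex.ofReal_one]
      choose z hz1 hz2 using hz
      have htr : ∑ i, (E i).trace.re = d := by
        rw [← Complex.re_sum, ← trace_sum, hE.2, trace_one, hd]
        simp
      refine mem_convexHull_of_exists_fintype (fun i => d⁻¹ * (E i).trace.re)
        (fun i => (z i, scaledEntropy (conditioned ρ (z i))))
        (fun i => mul_nonneg (by positivity) (posSemidef_trace_re_nonneg (hE.1 i))) ?_
        (fun i => ⟨z i, hz1 i, rfl⟩) ?_
      · rw [← Finset.mul_sum, htr, inv_mul_cancel₀ hd0.ne']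
      · refine Prod.ext ?_ ?_
        · simp only [Prod.fst_sum, Prod.smul_fst, mul_smul, ← hz2, ← Finset.smul_sum, hE.2]
        · simp only [Prod.snd_sum, Prod.smul_snd, smul_eq_mul, mul_assoc, ← Finset.mul_sum]
          congr 1
          refine Finset.sum_congr rfl fun i _ => ?_
          rw [← hscale _ _ (hz1 i).1, ← hz2]
    · rw [measurementGain_eq hρ hE]
      simp only
      rw [mul_inv_cancel_left₀ hd0.ne']
  · rintro ⟨p, ⟨hp, hp1⟩, rfl⟩
    obtain ⟨ι, _, w, z, hw, hw1, hz, hsum⟩ := mem_convexHull_iff_exists_fintype.1 hp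
    choose F hF hFz using hz
    let e := Fintype.equivFin ι
    have hP : IsPOVM fun j => (d * w (e.symm j)) • F (e.symm j) := by
      refine ⟨fun j => hpos _ _ (mul_nonneg hd0.le (hw _)) (hF _).1, ?_⟩
      rw [e.symm.sum_comp fun i => (d * w i) • F i]
      have h := congrArg Prod.fst hsum
      rw [hp1, Prod.fst_sum] at h
      simp only [← hFz, Prod.smul_fst] at h
      simp only [mul_smul, ← Finset.smul_sum, h]
      rw [smul_inv_smul₀ hd0.ne']
    refine ⟨_, _, hP, ?_⟩
    rw [measurementGain_eq hρ hP]
    simp only [hscale _ _ (hF _).1]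
    rw [e.symm.sum_comp fun i => d * w i * scaledEntropy (conditioned ρ (F i)), ← hsum,
      Prod.snd_sum]
    simp only [← hFz, Prod.smul_snd, smul_eq_mul, mul_assoc, ← Finset.mul_sum]

theorem isGreatest_classicalCorrelation [Nonempty B] {ρ : Matrix (A × B) (A × B) ℂ}
    (hρ : ρ.PosSemidef) : IsGreatest (gainSet ρ) (classicalCorrelation ρ) := by
  have hc : IsCompact (gainSet ρ) := by
    rw [gainSet_eq hρ]
    refine IsCompact.image ((isCompact_convexHull (isCompact_effectGraph hρ)).inter_right
      (isClosed_eq continuous_fst continuous_const)) ?_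
    fun_prop
  have hne : (gainSet ρ).Nonempty :=
    ⟨_, 1, fun _ => 1, ⟨fun _ => PosSemidef.one, by simp⟩, rfl⟩
  exact hc.isGreatest_sSup hne

end Attainment

/-! ### The pure-state equality and its extension by purification. -/

section Tripartite

set_option linter.unusedSectionVars false

theorem posSemidef_marginalAB {ρ : Matrix (A × B × C) (A × B × C) ℂ} (hρ : ρ.PosSemidef) :
    (marginalAB ρ).PosSemidef := by
  have h : marginalAB ρ = ∑ c, ρ.submatrix (fun x : A × B => (x.1, x.2, c))
      (fun x : A × B => (x.1, x.2, c)) := by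
    ext; simp [marginalAB, Matrix.sum_apply]
  rw [h]
  exact posSemidef_sum _ fun c _ => hρ.submatrix _

theorem posSemidef_marginalCB {ρ : Matrix (A × B × C) (A × B × C) ℂ} (hρ : ρ.PosSemidef) :
    (marginalCB ρ).PosSemidef := by
  have h : marginalCB ρ = ∑ a, ρ.submatrix (fun x : C × B => (a, x.2, x.1))
      (fun x : C × B => (a, x.2, x.1)) := by
    ext; simp [marginalCB, Matrix.sum_apply]
  rw [h]
  exact posSemidef_sum _ fun c _ => hρ.submatrix _

theorem traceLeft_marginalAB (ρ : Matrix (A × B × C) (A × B × C) ℂ) :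
    traceLeft (marginalAB ρ) = marginalB ρ := rfl

/-- The operator from `C` to `A` given by a tripartite vector and a bra on `B`. -/
noncomputable def partialBra (ψ : A × B × C → ℂ) (v : B → ℂ) : Matrix A C ℂ :=
  Matrix.of fun a c => ∑ b, star (v b) * ψ (a, b, c)

theorem conditioned_marginalAB_pure (ψ : A × B × C → ℂ) (v : B → ℂ) :
    conditioned (marginalAB (vecMulVec ψ (star ψ))) (vecMulVec v (star v)) =
      partialBra ψ v * (partialBra ψ v)ᴴ := by
  ext a a'
  simp only [conditioned_apply, marginalAB, of_apply, vecMulVec_apply, Pi.star_apply, mul_apply,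
    conjTranspose_apply, partialBra, star_sum, star_mul', star_star, Finset.sum_mul,
    Finset.mul_sum]
  refine Eq.trans ?_ Finset.sum_comm
  refine Finset.sum_congr rfl fun y _ => ?_
  rw [Finset.sum_comm]
  refine Finset.sum_congr rfl fun c _ => Finset.sum_congr rfl fun y _ => ?_
  ring

theorem conditioned_marginalCB_pure (ψ : A × B × C → ℂ) (v : B → ℂ) :
    conditioned (marginalCB (vecMulVec ψ (star ψ))) (vecMulVec v (star v)) =
      ((partialBra ψ v)ᴴ * partialBra ψ v)ᵀ := by
  ext a a'
  simp only [conditioned_apply, marginalCB, of_apply, vecMulVec_apply, Pi.star_apply, mul_apply,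
    conjTranspose_apply, transpose_apply, partialBra, star_sum, star_mul', star_star,
    Finset.sum_mul, Finset.mul_sum]
  refine (Finset.sum_comm.trans ?_).trans Finset.sum_comm
  refine Finset.sum_congr rfl fun b _ => ?_
  rw [Finset.sum_comm]
  refine Finset.sum_congr rfl fun c _ => Finset.sum_congr rfl fun y _ => ?_
  ring

/-- With `N = partialBra ψ v`, the conditional operators are `N * Nᴴ` and `(Nᴴ * N)ᵀ`, which have
equal trace and equal nonzero spectrum. -/
theorem scaledEntropy_conditioned_pure (ψ : A × B × C → ℂ) (v : B → ℂ) :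
    scaledEntropy (conditioned (marginalAB (vecMulVec ψ (star ψ))) (vecMulVec v (star v))) =
      scaledEntropy (conditioned (marginalCB (vecMulVec ψ (star ψ))) (vecMulVec v (star v))) := by
  rw [conditioned_marginalAB_pure, conditioned_marginalCB_pure, scaledEntropy, scaledEntropy,
    trace_transpose, entropy_transpose (isHermitian_conjTranspose_mul_self _),
    entropy_mul_conjTranspose, trace_mul_comm]

/-- The same argument across the cut `AB : C`, with `ψ` reshaped into a matrix. -/
theorem entropy_marginalAB_pure (ψ : A × B × C → ℂ) :
    entropy (marginalAB (vecMulVec ψ (star ψ))) =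
      entropy (traceRight (marginalCB (vecMulVec ψ (star ψ)))) := by
  let N : Matrix (A × B) C ℂ := Matrix.of fun x c => ψ (x.1, x.2, c)
  have h1 : marginalAB (vecMulVec ψ (star ψ)) = N * Nᴴ := by
    ext; simp [marginalAB, N, mul_apply, vecMulVec_apply]
  have h2 : traceRight (marginalCB (vecMulVec ψ (star ψ))) = (Nᴴ * N)ᵀ := by
    ext c c'
    simp only [traceRight, marginalCB, N, mul_apply, vecMulVec_apply, of_apply, transpose_apply,
      conjTranspose_apply, Fintype.sum_prod_type, Pi.star_apply]
    rw [Finset.sum_comm]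
    exact Finset.sum_congr rfl fun a _ => Finset.sum_congr rfl fun b _ => mul_comm _ _
  rw [h1, h2, entropy_transpose (isHermitian_conjTranspose_mul_self _), entropy_mul_conjTranspose]

/-- Each side is minus the least average conditional entropy. Refining an optimal measurement for
one side to rank one gives a measurement with the same average on the other side, whence both
inequalities. -/
theorem classicalCorrelation_sub_pure [Nonempty B] (ψ : A × B × C → ℂ) :
    classicalCorrelation (marginalAB (vecMulVec ψ (star ψ)))
        - entropy (traceRight (marginalAB (vecMulVec ψ (star ψ)))) =
      classicalCorrelation (marginalCB (vecMulVec ψ (star ψ)))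
        - entropy (traceRight (marginalCB (vecMulVec ψ (star ψ)))) := by
  have hψ := posSemidef_vecMulVec_self_star ψ
  have hAB := posSemidef_marginalAB hψ
  have hCB := posSemidef_marginalCB hψ
  have gAB := isGreatest_classicalCorrelation hAB
  have gCB := isGreatest_classicalCorrelation hCB
  apply le_antisymm
  · obtain ⟨n, E, hE, hJ⟩ := gAB.1
    obtain ⟨m, v, hv, hle⟩ := exists_rankOne_refinement (A := A) hE
    have h1 := hle _ hAB
    have h2 := gCB.2 ⟨m, _, hv, rfl⟩
    rw [measurementGain_eq hAB hv] at h1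
    rw [measurementGain_eq hCB hv] at h2
    simp only [scaledEntropy_conditioned_pure] at h1
    linarith
  · obtain ⟨n, E, hE, hJ⟩ := gCB.1
    obtain ⟨m, v, hv, hle⟩ := exists_rankOne_refinement (A := C) hE
    have h1 := hle _ hCB
    have h2 := gAB.2 ⟨m, _, hv, rfl⟩
    rw [measurementGain_eq hCB hv] at h1
    rw [measurementGain_eq hAB hv] at h2
    simp only [scaledEntropy_conditioned_pure] at h2
    linarith

/-- The Koashi–Winter relation for pure tripartite states. -/
theorem discord_add_classicalCorrelation_pure [Nonempty B] (ψ : A × B × C → ℂ) :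
    discord (marginalAB (vecMulVec ψ (star ψ)))
        + classicalCorrelation (marginalCB (vecMulVec ψ (star ψ))) =
      entropy (marginalB (vecMulVec ψ (star ψ))) := by
  have h1 := classicalCorrelation_sub_pure ψ
  have h2 := entropy_marginalAB_pure ψ
  rw [discord, mutualInfo, traceLeft_marginalAB]
  linarith

/-- Discarding a part of the unmeasured system does not increase the classical correlation. -/
theorem classicalCorrelation_le_of_extension [Nonempty B] [Nonempty Y]
    {ρ : Matrix (X × B) (X × B) ℂ} {σ : Matrix ((X × Y) × B) ((X × Y) × B) ℂ}
    (hρ : ρ.PosSemidef) (hσ : σ.PosSemidef)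
    (h : ∀ x b x' b', ρ (x, b) (x', b') = ∑ y, σ ((x, y), b) ((x', y), b')) :
    classicalCorrelation ρ ≤ classicalCorrelation σ := by
  obtain ⟨n, E, hE, hJ⟩ := (isGreatest_classicalCorrelation hρ).1
  refine le_trans ?_ ((isGreatest_classicalCorrelation hσ).2 ⟨n, E, hE, rfl⟩)
  rw [hJ, measurementGain_eq hρ hE, measurementGain_eq hσ hE]
  have hc : ∀ F, conditioned ρ F = traceRight (conditioned σ F) := by
    intro F
    ext x x'
    simp only [conditioned_apply, traceRight, of_apply, h, Finset.mul_sum]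
    refine Eq.trans ?_ Finset.sum_comm
    exact Finset.sum_congr rfl fun y _ => Finset.sum_comm
  -- Keeping the optimal measurement for `ρ`, Holevo monotonicity compares the two conditional
  -- ensembles; their probabilities agree because partial trace preserves trace.
  have hm := entropy_traceRight_sub_sum_le fun i => posSemidef_conditioned hσ (hE.1 i)
  rw [← conditioned_sum, ← hc, hE.2, conditioned_one, conditioned_one] at hm
  simp only [← hc] at hm
  have ht : ∀ i, (conditioned ρ (E i)).trace = (conditioned σ (E i)).trace := fun i => by
    rw [hc, trace_traceRight]
  simp only [scaledEntropy, Finset.sum_add_distrib, ht]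
  linarith

theorem nonempty_of_isState {ρ : Matrix X X ℂ} (hρ : IsState ρ) : Nonempty X := by
  by_contra h
  rw [not_nonempty_iff] at h
  have := hρ.2
  simp [trace] at this

theorem discord_add_classicalCorrelation_le {ρ : Matrix (A × B × C) (A × B × C) ℂ}
    (hρ : IsState ρ) :
    discord (marginalAB ρ) + classicalCorrelation (marginalCB ρ) ≤ entropy (marginalB ρ) := by
  have hne := nonempty_of_isState hρ
  have : Nonempty B := hne.map fun x => x.2.1
  obtain ⟨G, hG⟩ := exists_eq_conjTranspose_mul_self hρ.1
  -- Since `ρ = Gᴴ * G`, the conjugated entries of `G` form a purification whose row index is the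
  -- reference. Attaching it to `C` leaves the marginals on `AB` and `B` unchanged.
  let ψ : A × B × (C × (A × B × C)) → ℂ := fun x => star (G x.2.2.2 (x.1, x.2.1, x.2.2.1))
  have hψ : ∀ a b c a' b' c', ρ (a, b, c) (a', b', c') =
      ∑ r, vecMulVec ψ (star ψ) (a, b, c, r) (a', b', c', r) := by
    intro a b c a' b' c'
    rw [hG, mul_apply]
    simp only [ψ, vecMulVec_apply, Pi.star_apply, star_star, conjTranspose_apply]
  have h := discord_add_classicalCorrelation_pure ψ
  have hAB : marginalAB (vecMulVec ψ (star ψ)) = marginalAB ρ := by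
    ext x x'
    simp only [marginalAB, of_apply, hψ, Fintype.sum_prod_type (α₁ := C)]
  have hB : marginalB (vecMulVec ψ (star ψ)) = marginalB ρ := by
    rw [← traceLeft_marginalAB, hAB, traceLeft_marginalAB]
  rw [hAB, hB] at h
  rw [← h]
  have hp := posSemidef_vecMulVec_self_star ψ
  refine add_le_add_right (classicalCorrelation_le_of_extension (posSemidef_marginalCB hρ.1)
    (posSemidef_marginalCB hp) fun c b c' b' => ?_) _
  simp only [marginalCB, of_apply, hψ]
  exact Finset.sum_comm

end Tripartite

end QuantumDiscord

/-- The trade-off between discord and classical correlation. The first two conjuncts say that the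
maxima over POVMs which define `J(A|B)` and `J(C|B)` are attained. -/
theorem mainTheorem3 {A B C : Type*} [Fintype A] [DecidableEq A] [Fintype B] [DecidableEq B]
    [Fintype C] [DecidableEq C] (ρ : Matrix (A × B × C) (A × B × C) ℂ)
    (hρ : QuantumDiscord.IsState ρ) :
    IsGreatest (QuantumDiscord.gainSet (QuantumDiscord.marginalAB ρ))
        (QuantumDiscord.classicalCorrelation (QuantumDiscord.marginalAB ρ)) ∧
      IsGreatest (QuantumDiscord.gainSet (QuantumDiscord.marginalCB ρ))
        (QuantumDiscord.classicalCorrelation (QuantumDiscord.marginalCB ρ)) ∧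
      QuantumDiscord.discord (QuantumDiscord.marginalAB ρ) +
          QuantumDiscord.classicalCorrelation (QuantumDiscord.marginalCB ρ) ≤
        QuantumDiscord.entropy (QuantumDiscord.marginalB ρ) ∧
      (QuantumDiscord.IsPure ρ →
        QuantumDiscord.discord (QuantumDiscord.marginalAB ρ) +
            QuantumDiscord.classicalCorrelation (QuantumDiscord.marginalCB ρ) =
          QuantumDiscord.entropy (QuantumDiscord.marginalB ρ)) := by
  have hne := QuantumDiscord.nonempty_of_isState hρ
  have : Nonempty B := hne.map fun x => x.2.1
  refine ⟨QuantumDiscord.isGreatest_classicalCorrelation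
      (QuantumDiscord.posSemidef_marginalAB hρ.1),
    QuantumDiscord.isGreatest_classicalCorrelation (QuantumDiscord.posSemidef_marginalCB hρ.1),
    QuantumDiscord.discord_add_classicalCorrelation_le hρ, ?_⟩
  rintro ⟨ψ, rfl⟩
  exact QuantumDiscord.discord_add_classicalCorrelation_pure ψ
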